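/- For an integer $m\ge 0$ let $\mathbb{S}^m=\{x\in\mathbb{R}^{m+1}: \|x\|=1\}$ be the unit sphere, regarded as a metric space with the geodesic distance $d_{\mathbb{S}^m}(x,x')=\arccos\langle x,x'\rangle$. A correspondence between two sets $X$ and $Y$ is a relation $R\subseteq X\times Y$ whose projections to $X$ and to $Y$ are both surjective; if $X$ and $Y$ are bounded metric spaces and $R$ is non-empty, its distortion is $\operatorname{dis}(R)=\sup_{(x,y),(x',y')\in R}|d_X(x,x')-d_Y(y,y')|$. Let $d_{\mathrm{GH}}(X,Y)$ denote the Gromov–Hausdorff distance, i.e. the infimum of the Hausdorff distances between $f(X)$ and $g(Y)$ over all metric spaces $Z$ and all isometric embeddings $f:X\to Z$ and $g:Y\to Z$. Then there exists a correspondence $R$ between $\mathbb{S}^1$ and $\mathbb{S}^3$ with $\operatorname{dis}(R)\le \frac{2\pi}{3}$. Moreover, $d_{\mathrm{GH}}(\mathbb{S}^1,\mathbb{S}^3)=\frac{\pi}{3}$. -/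

import Mathlib

noncomputable section

/-- The `m`-dimensional sphere, as the set of unit vectors of `ℝ^(m+1)`. This is a type synonym,
so that it does not inherit the Euclidean (chordal) metric: it is given the geodesic one below. -/
def GeodesicSphere (m : ℕ) : Type :=
  {x : EuclideanSpace ℝ (Fin (m + 1)) // ‖x‖ = 1}

namespace GeodesicSphere

/-- The unit vector underlying a point of the sphere. -/
def vec {m : ℕ} (x : GeodesicSphere m) : EuclideanSpace ℝ (Fin (m + 1)) := x.1

theorem norm_vec {m : ℕ} (x : GeodesicSphere m) : ‖x.vec‖ = 1 := x.2

/-- The geodesic distance `arccos ⟨x, y⟩`. -/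
def geodDist {m : ℕ} (x y : GeodesicSphere m) : ℝ :=
  Real.arccos (inner ℝ x.vec y.vec)

theorem geodDist_eq_angle {m : ℕ} (x y : GeodesicSphere m) :
    geodDist x y = InnerProductGeometry.angle x.vec y.vec := by
  simp [geodDist, InnerProductGeometry.angle, norm_vec]

/-- The sphere with its geodesic distance is a metric space. -/
instance instMetricSpace (m : ℕ) : MetricSpace (GeodesicSphere m) where
  dist := geodDist
  dist_self x := by
    change geodDist x x = 0
    simp [geodDist, norm_vec]
  dist_comm x y := by
    change geodDist x y = geodDist y x
    simp only [geodDist, real_inner_comm]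
  dist_triangle x y z := by
    change geodDist x z ≤ geodDist x y + geodDist y z
    simp only [geodDist_eq_angle]
    exact InnerProductGeometry.angle_le_angle_add_angle _ _ _
  eq_of_dist_eq_zero {x y} h := by
    change geodDist x y = 0 at h
    have h1 : (1 : ℝ) ≤ inner ℝ x.vec y.vec := Real.arccos_eq_zero.mp h
    have h2 : inner ℝ x.vec y.vec ≤ (1 : ℝ) := by
      simpa [norm_vec] using real_inner_le_norm x.vec y.vec
    exact Subtype.ext
      ((inner_eq_one_iff_of_norm_eq_one (norm_vec x) (norm_vec y)).mp (le_antisymm h2 h1))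

theorem dist_def {m : ℕ} (x y : GeodesicSphere m) :
    dist x y = Real.arccos (inner ℝ x.vec y.vec) := rfl

instance instNonempty (m : ℕ) : Nonempty (GeodesicSphere m) :=
  ⟨⟨EuclideanSpace.single 0 1, by simp⟩⟩

instance instCompactSpace (m : ℕ) : CompactSpace (GeodesicSphere m) := by
  let f : Metric.sphere (0 : EuclideanSpace ℝ (Fin (m + 1))) 1 → GeodesicSphere m :=
    fun x => ⟨x.1, by simpa using x.2⟩
  have hf : Continuous f := by
    rw [continuous_iff_continuousAt]
    intro x
    refine tendsto_iff_dist_tendsto_zero.mpr ?_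
    have hc : Continuous fun y : Metric.sphere (0 : EuclideanSpace ℝ (Fin (m + 1))) 1 =>
        Real.arccos (inner ℝ y.1 x.1) := by fun_prop
    have h0 : Real.arccos (inner ℝ x.1 x.1) = 0 := dist_self (f x)
    have := hc.tendsto x
    rw [h0] at this
    exact this
  have hs : Function.Surjective f := fun y => ⟨⟨y.1, by simpa using y.2⟩, rfl⟩
  exact hs.compactSpace hf

end GeodesicSphere

/-- A relation `R ⊆ X × Y` is a correspondence if both projections map it onto the whole factor. -/
def IsCorrespondence {X Y : Type*} (R : Set (X × Y)) : Prop :=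
  Prod.fst '' R = Set.univ ∧ Prod.snd '' R = Set.univ

/-- The distortion `sup |d(x, x') - d(y, y')|` over all `(x, y), (x', y') ∈ R`. It takes values in
`[0, ∞]`, so that the supremum is always the true one. -/
def distortion {X Y : Type*} [MetricSpace X] [MetricSpace Y] (R : Set (X × Y)) : ENNReal :=
  ⨆ p ∈ R, ⨆ q ∈ R, ENNReal.ofReal |dist p.1 q.1 - dist p.2 q.2|

end

/-!
The points of `𝕊³ ⊆ ℂ²` are the joins `(cos t • x, sin t • y)` with `x`, `y` on `𝕊¹` and `t` in
`[0, π / 2]`. For the upper bound, such a point is related to the cube roots of `y` within `π / 3`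
of `x`. If `u`, `u'` at distance `d` are related to the joins of `x`, `y` and `x'`, `y'`, then
`dist x x' ≤ 2 * π / 3 + d` by the triangle inequality and `dist y y' ≤ min (3 * d) π`, which is
again at most `2 * π / 3 + d`. Since this bound is at least `π / 2`, it passes to the joins. The
reverse inequality follows since the relation is invariant under the antipodal map.

For the lower bound, a correspondence between `𝕊¹` and `𝕊ⁿ` with `2 ≤ n`, once symmetrised,
contains the graph of an odd function `f : 𝕊ⁿ → 𝕊¹`. If `f` moved nearby points by less than
`2 * π / 3`, then `f` could not turn around the circle along a small triangle, so the total turning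
of `f` along a loop would be invariant under discrete homotopies. But it is nonzero along a great
circle, by oddness, and zero along a constant loop. So `f` has jumps of size at least `2 * π / 3`,
and the distortion is at least that.
-/

open Real Function

section Correspondence

variable {X Y : Type*} {R : Set (X × Y)}

theorem IsCorrespondence.surjective_fst (hR : IsCorrespondence R) :
    Surjective fun p : R => p.1.1 := by
  rw [← Set.range_eq_univ, ← hR.1, Set.image_eq_range]

theorem IsCorrespondence.surjective_snd (hR : IsCorrespondence R) :
    Surjective fun p : R => p.1.2 := by
  rw [← Set.range_eq_univ, ← hR.2, Set.image_eq_range]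

variable [MetricSpace X] [MetricSpace Y]

theorem distortion_le_ofReal {r : ℝ}
    (h : ∀ p ∈ R, ∀ q ∈ R, |dist p.1 q.1 - dist p.2 q.2| ≤ r) :
    distortion R ≤ ENNReal.ofReal r :=
  iSup₂_le fun p hp => iSup₂_le fun q hq => ENNReal.ofReal_le_ofReal (h p hp q hq)

theorem abs_dist_sub_dist_le_toReal_distortion (hR : distortion R ≠ ⊤) {x x' : X} {y y' : Y}
    (h : (x, y) ∈ R) (h' : (x', y') ∈ R) :
    |dist x x' - dist y y'| ≤ (distortion R).toReal := by
  rw [← ENNReal.ofReal_le_iff_le_toReal hR]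
  exact le_iSup₂_of_le (x, y) h <| le_iSup₂_of_le (x', y') h' le_rfl

variable [CompactSpace X] [Nonempty X] [CompactSpace Y] [Nonempty Y]

theorem ghDist_le_of_surjective {Z : Type*} {Φ : Z → X} {Ψ : Z → Y}
    (hΦ : Surjective Φ) (hΨ : Surjective Ψ) {ε : ℝ} (hε : 0 < ε)
    (H : ∀ p q, |dist (Φ p) (Φ q) - dist (Ψ p) (Ψ q)| ≤ 2 * ε) :
    GromovHausdorff.ghDist X Y ≤ ε := by
  have : Nonempty Z := (hΦ (Classical.arbitrary X)).nonempty
  let _ : MetricSpace (X ⊕ Y) := Metric.glueMetricApprox Φ Ψ ε hε H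
  have isometry_inl : Isometry (Sum.inl : X → X ⊕ Y) := Isometry.of_dist_eq fun _ _ => rfl
  have isometry_inr : Isometry (Sum.inr : Y → X ⊕ Y) := Isometry.of_dist_eq fun _ _ => rfl
  have dist_glued (p : Z) : dist (Sum.inl (Φ p) : X ⊕ Y) (Sum.inr (Ψ p)) ≤ ε :=
    (Metric.glueDist_glued_points Φ Ψ ε p).le
  refine (GromovHausdorff.ghDist_le_hausdorffDist isometry_inl isometry_inr).trans
    (Metric.hausdorffDist_le_of_mem_dist hε.le ?_ ?_)
  · rintro _ ⟨x, rfl⟩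
    obtain ⟨p, rfl⟩ := hΦ x
    exact ⟨_, Set.mem_range_self (Ψ p), dist_glued p⟩
  · rintro _ ⟨y, rfl⟩
    obtain ⟨p, rfl⟩ := hΨ y
    exact ⟨_, Set.mem_range_self (Φ p), (dist_comm _ _).trans_le (dist_glued p)⟩

theorem IsCorrespondence.ofReal_two_mul_ghDist_le_distortion (hR : IsCorrespondence R) :
    ENNReal.ofReal (2 * GromovHausdorff.ghDist X Y) ≤ distortion R := by
  rcases eq_or_ne (distortion R) ⊤ with htop | htop
  · exact htop ▸ le_top
  rw [ENNReal.ofReal_le_iff_le_toReal htop]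
  refine le_of_forall_pos_le_add fun δ hδ => ?_
  have hgh : GromovHausdorff.ghDist X Y ≤ ((distortion R).toReal + δ) / 2 := by
    refine ghDist_le_of_surjective hR.surjective_fst hR.surjective_snd (by positivity) fun p q => ?_
    linarith [abs_dist_sub_dist_le_toReal_distortion htop p.2 q.2]
  linarith

theorem exists_dist_le_hausdorffDist {Z : Type*} [PseudoMetricSpace Z] {s t : Set Z}
    (hs : Bornology.IsBounded s) (ht : IsCompact t) (ht_ne : t.Nonempty) {x : Z} (hx : x ∈ s) :
    ∃ y ∈ t, dist x y ≤ Metric.hausdorffDist s t := by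
  obtain ⟨y, hy, hxy⟩ := ht.exists_infDist_eq_dist ht_ne x
  refine ⟨y, hy, hxy ▸ Metric.infDist_le_hausdorffDist_of_mem hx ?_⟩
  exact Metric.hausdorffEDist_ne_top_of_nonempty_of_bounded ⟨x, hx⟩ ht_ne hs ht.isBounded

variable (X Y) in
theorem exists_isCorrespondence_distortion_le_ghDist :
    ∃ R : Set (X × Y), IsCorrespondence R ∧
      distortion R ≤ ENNReal.ofReal (2 * GromovHausdorff.ghDist X Y) := by
  set ι := GromovHausdorff.optimalGHInjl X Y
  set κ := GromovHausdorff.optimalGHInjr X Y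
  have hι : Isometry ι := GromovHausdorff.isometry_optimalGHInjl X Y
  have hκ : Isometry κ := GromovHausdorff.isometry_optimalGHInjr X Y
  have hι_compact : IsCompact (Set.range ι) := isCompact_range hι.continuous
  have hκ_compact : IsCompact (Set.range κ) := isCompact_range hκ.continuous
  have hopt : Metric.hausdorffDist (Set.range ι) (Set.range κ) = GromovHausdorff.ghDist X Y :=
    GromovHausdorff.hausdorffDist_optimal
  refine ⟨{p | dist (ι p.1) (κ p.2) ≤ GromovHausdorff.ghDist X Y}, ⟨?_, ?_⟩,
    distortion_le_ofReal fun p hp q hq => ?_⟩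
  · refine Set.eq_univ_of_forall fun x => ?_
    obtain ⟨_, ⟨y, rfl⟩, hxy⟩ := exists_dist_le_hausdorffDist hι_compact.isBounded hκ_compact
      (Set.range_nonempty κ) (Set.mem_range_self x)
    exact ⟨(x, y), hxy.trans_eq hopt, rfl⟩
  · refine Set.eq_univ_of_forall fun y => ?_
    obtain ⟨_, ⟨x, rfl⟩, hyx⟩ := exists_dist_le_hausdorffDist hκ_compact.isBounded hι_compact
      (Set.range_nonempty ι) (Set.mem_range_self y)
    rw [dist_comm, Metric.hausdorffDist_comm] at hyx
    exact ⟨(x, y), hyx.trans_eq hopt, rfl⟩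
  · rw [← hι.dist_eq, ← hκ.dist_eq, two_mul, ← Real.dist_eq]
    exact (dist_dist_dist_le _ _ _ _).trans (add_le_add hp hq)

end Correspondence

section Angle

theorem norm_coe_angle_le (x : ℝ) : ‖(x : Angle)‖ ≤ |x| :=
  QuotientAddGroup.norm_mk_le_norm

theorem norm_coe_angle_of_abs_le_pi {x : ℝ} (hx : |x| ≤ π) : ‖(x : Angle)‖ = |x| :=
  (AddCircle.norm_coe_eq_abs_iff (2 * π) two_pi_pos.ne').mpr
    (by rwa [abs_of_pos two_pi_pos, mul_div_cancel_left₀ _ two_ne_zero])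

theorem norm_angle_eq_abs_toReal (θ : Angle) : ‖θ‖ = |θ.toReal| := by
  rw [← norm_coe_angle_of_abs_le_pi θ.abs_toReal_le_pi, θ.coe_toReal]

theorem arccos_cos_angle (θ : Angle) : arccos θ.cos = ‖θ‖ := by
  rw [norm_angle_eq_abs_toReal, ← θ.cos_toReal, ← cos_abs,
    arccos_cos (abs_nonneg _) θ.abs_toReal_le_pi]

theorem cos_sub_angle (θ ψ : Angle) : (θ - ψ).cos = θ.cos * ψ.cos + θ.sin * ψ.sin := by
  rw [sub_eq_add_neg, Angle.cos_add, Angle.cos_neg, Angle.sin_neg]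
  ring

theorem exists_angle_cos_eq_sin_eq {a b : ℝ} (h : a ^ 2 + b ^ 2 = 1) :
    ∃ θ : Angle, θ.cos = a ∧ θ.sin = b := by
  have hnorm : ‖(⟨a, b⟩ : ℂ)‖ = 1 := by
    rw [Complex.norm_eq_sqrt_sq_add_sq, h, sqrt_one]
  refine ⟨(⟨a, b⟩ : ℂ).arg, ?_, ?_⟩
  · simpa [hnorm] using Complex.norm_mul_cos_arg ⟨a, b⟩
  · simpa [hnorm] using Complex.norm_mul_sin_arg ⟨a, b⟩

theorem exists_nsmul_eq_dist_le {n : ℕ} (hn : n ≠ 0) (α β : Angle) :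
    ∃ θ : Angle, n • θ = α ∧ dist β θ ≤ π / n := by
  set τ : ℝ := (α - n • β).toReal / n with hτ
  refine ⟨β + τ, ?_, ?_⟩
  · rw [smul_add, ← Angle.natCast_mul_eq_nsmul τ, hτ, mul_div_cancel₀ _ (by positivity),
      Angle.coe_toReal, add_sub_cancel]
  · rw [dist_self_add_right]
    calc ‖(τ : Angle)‖ ≤ |τ| := norm_coe_angle_le τ
      _ = |(α - n • β).toReal| / n := by rw [hτ, abs_div, Nat.abs_cast]
      _ ≤ π / n := by gcongr; exact Angle.abs_toReal_le_pi _

theorem toReal_sub_add_toReal_sub {a b c : Angle} (h : dist a b + dist b c + dist a c < 2 * π) :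
    (b - a).toReal + (c - b).toReal = (c - a).toReal := by
  have hcoe : (((b - a).toReal + (c - b).toReal : ℝ) : Angle) = ((c - a).toReal : ℝ) := by
    rw [Angle.coe_add, Angle.coe_toReal, Angle.coe_toReal, Angle.coe_toReal]
    abel
  obtain ⟨k, hk⟩ := Angle.angle_eq_iff_two_pi_dvd_sub.mp hcoe
  simp only [dist_eq_norm', norm_angle_eq_abs_toReal] at h
  have hlt : |2 * π * k| < 2 * π * 1 := by
    rw [← hk, mul_one]
    exact ((abs_sub _ _).trans (add_le_add_left (abs_add_le _ _) _)).trans_lt h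
  rw [abs_mul, abs_of_pos two_pi_pos, mul_lt_mul_iff_right₀ two_pi_pos, ← Int.cast_abs] at hlt
  have hk0 : k = 0 := Int.abs_lt_one_iff.mp (by exact_mod_cast hlt)
  rwa [hk0, Int.cast_zero, mul_zero, sub_eq_zero] at hk

end Angle

section Turning

/-- The total signed turning of the discrete path `γ 0, …, γ n` on the circle, each step being taken
along its shortest arc. For a loop, it is `2π` times a discrete winding number. -/
noncomputable def turning (γ : ℕ → Angle) (n : ℕ) : ℝ :=
  ∑ j ∈ Finset.range n, (γ (j + 1) - γ j).toReal

theorem coe_turning (γ : ℕ → Angle) (n : ℕ) : (turning γ n : Angle) = γ n - γ 0 := by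
  rw [turning, ← Angle.coe_coeHom, map_sum]
  simp only [Angle.coe_coeHom, Angle.coe_toReal, Finset.sum_range_sub]

theorem turning_eq_zero_of_forall_eq {γ : ℕ → Angle} (h : ∀ j, γ j = γ 0) (n : ℕ) :
    turning γ n = 0 :=
  Finset.sum_eq_zero fun j _ => by rw [h (j + 1), h j, sub_self, Angle.toReal_zero]

theorem turning_two_mul_of_antiperiodic {γ : ℕ → Angle} {N : ℕ} (h : ∀ j, γ (j + N) = γ j + π) :
    turning γ (2 * N) = 2 * turning γ N := by
  have hshift (j : ℕ) : γ (N + j + 1) - γ (N + j) = γ (j + 1) - γ j := by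
    rw [add_assoc, add_comm N, add_comm N, h, h, add_sub_add_right_eq_sub]
  simp only [turning, two_mul, Finset.sum_range_add, hshift]

theorem turning_two_mul_ne_zero_of_antiperiodic {γ : ℕ → Angle} {N : ℕ}
    (h : ∀ j, γ (j + N) = γ j + π) : turning γ (2 * N) ≠ 0 := by
  intro hzero
  have hhalf : turning γ N = 0 := by
    linarith [turning_two_mul_of_antiperiodic h]
  have hcoe := coe_turning γ N
  rw [hhalf, ← zero_add N, h, add_sub_cancel_left, Angle.coe_zero] at hcoe
  exact Angle.pi_ne_zero hcoe.symm

theorem turning_eq_of_dist_lt {γ γ' : ℕ → Angle} {n : ℕ} (hγ : γ n = γ 0) (hγ' : γ' n = γ' 0)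
    (hstep : ∀ j, dist (γ j) (γ (j + 1)) < 2 * π / 3)
    (hstep' : ∀ j, dist (γ' j) (γ' (j + 1)) < 2 * π / 3)
    (hdist : ∀ j, dist (γ j) (γ' j) < 2 * π / 3)
    (hdiag : ∀ j, dist (γ j) (γ' (j + 1)) < 2 * π / 3) : turning γ' n = turning γ n := by
  have hsquare (j : ℕ) : (γ' (j + 1) - γ' j).toReal - (γ (j + 1) - γ j).toReal =
      (γ' (j + 1) - γ (j + 1)).toReal - (γ' j - γ j).toReal := by
    have hlower : dist (γ j) (γ (j + 1)) + dist (γ (j + 1)) (γ' (j + 1)) +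
        dist (γ j) (γ' (j + 1)) < 2 * π := by linarith [hstep j, hdist (j + 1), hdiag j]
    have hupper : dist (γ j) (γ' j) + dist (γ' j) (γ' (j + 1)) +
        dist (γ j) (γ' (j + 1)) < 2 * π := by linarith [hstep' j, hdist j, hdiag j]
    linarith [toReal_sub_add_toReal_sub hlower, toReal_sub_add_toReal_sub hupper]
  rw [← sub_eq_zero, turning, turning, ← Finset.sum_sub_distrib,
    Finset.sum_congr rfl fun j _ => hsquare j,
    Finset.sum_range_sub fun j => (γ' j - γ j).toReal, hγ, hγ', sub_self]

theorem turning_row_eq {F : ℕ → ℕ → Angle} {n : ℕ} (hloop : ∀ i, F i n = F i 0)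
    (hclose : ∀ i j, ∀ a ≤ 1, ∀ b ≤ 1, dist (F i j) (F (i + a) (j + b)) < 2 * π / 3) (i : ℕ) :
    turning (F i) n = turning (F 0) n := by
  induction i with
  | zero => rfl
  | succ i ih =>
    rw [← ih]
    exact turning_eq_of_dist_lt (hloop i) (hloop (i + 1))
      (fun j => hclose i j 0 zero_le_one 1 le_rfl)
      (fun j => hclose (i + 1) j 0 zero_le_one 1 le_rfl)
      (fun j => hclose i j 1 le_rfl 0 zero_le_one) (fun j => hclose i j 1 le_rfl 1 le_rfl)

end Turning

theorem exists_semiconj_of_forall_exists {A B : Type*} {σ : A → A} {τ : B → B}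
    (hσ : Involutive σ) (hσ_ne : ∀ a, σ a ≠ a) (hτ : Involutive τ) {S : A → B → Prop}
    (hS : ∀ a b, S a b → S (σ a) (τ b)) (htotal : ∀ a, ∃ b, S a b) :
    ∃ f : A → B, Semiconj f σ τ ∧ ∀ a, S a (f a) := by
  choose g hg using htotal
  -- A linear order picks one point of each `σ`-orbit; the value of `f` there is free.
  let _ : LinearOrder A := WellOrderingRel.isWellOrder.linearOrder
  refine ⟨fun a => if a < σ a then g a else τ (g (σ a)), fun a => ?_, fun a => ?_⟩
  · rcases lt_or_gt_of_ne (hσ_ne a) with h | h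
    · simp only [hσ a, if_pos h, if_neg h.not_gt, hτ (g (σ a))]
    · simp only [hσ a, if_pos h, if_neg h.not_gt]
  · dsimp only
    split_ifs
    · exact hg a
    · simpa only [hσ a] using hS _ _ (hg (σ a))

namespace GeodesicSphere

section Antipode

variable {m n : ℕ}

/-- The antipodal map, as negation. -/
instance : InvolutiveNeg (GeodesicSphere m) where
  neg x := ⟨-x.vec, by rw [norm_neg, norm_vec]⟩
  neg_neg x := Subtype.ext (neg_neg x.vec)

theorem vec_neg (x : GeodesicSphere m) : (-x).vec = -x.vec := rfl

theorem vec_injective : Injective (vec : GeodesicSphere m → _) :=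
  Subtype.val_injective

theorem inner_vec (x y : GeodesicSphere m) : inner ℝ x.vec y.vec = cos (dist x y) := by
  have h : |inner ℝ x.vec y.vec| ≤ 1 := by
    simpa only [norm_vec, mul_one] using abs_real_inner_le_norm x.vec y.vec
  rw [dist_def, cos_arccos (abs_le.mp h).1 (abs_le.mp h).2]

theorem dist_le_pi (x y : GeodesicSphere m) : dist x y ≤ π :=
  arccos_le_pi _

theorem dist_neg_left (x y : GeodesicSphere m) : dist (-x) y = π - dist x y := by
  rw [dist_def, dist_def, vec_neg, inner_neg_left, arccos_neg]

theorem dist_neg_right (x y : GeodesicSphere m) : dist x (-y) = π - dist x y := by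
  rw [dist_comm, dist_neg_left, dist_comm]

theorem neg_ne_self (x : GeodesicSphere m) : -x ≠ x := by
  intro h
  have hdist := dist_neg_left x x
  rw [h, dist_self, sub_zero] at hdist
  exact pi_ne_zero hdist.symm

theorem abs_dist_neg_left_sub_dist_neg_left (u v : GeodesicSphere m) (x y : GeodesicSphere n) :
    |dist (-u) v - dist (-x) y| = |dist u v - dist x y| := by
  rw [dist_neg_left, dist_neg_left, sub_sub_sub_cancel_left, abs_sub_comm]

theorem abs_dist_neg_right_sub_dist_neg_right (u v : GeodesicSphere m) (x y : GeodesicSphere n) :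
    |dist u (-v) - dist x (-y)| = |dist u v - dist x y| := by
  rw [dist_neg_right, dist_neg_right, sub_sub_sub_cancel_left, abs_sub_comm]

end Antipode

section Circle

/-- The point of the circle `𝕊¹` with a given polar angle. -/
noncomputable def ofAngle (θ : Angle) : GeodesicSphere 1 :=
  ⟨!₂[θ.cos, θ.sin], by
    rw [EuclideanSpace.norm_eq, Fin.sum_univ_two, Real.sqrt_eq_one]
    simp⟩

theorem isometry_ofAngle : Isometry ofAngle := by
  refine Isometry.of_dist_eq fun θ ψ => ?_
  rw [dist_eq_norm, ← arccos_cos_angle, cos_sub_angle, dist_def, PiLp.inner_apply,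
    Fin.sum_univ_two]
  simp [ofAngle, vec, mul_comm]

theorem surjective_ofAngle : Surjective ofAngle := by
  intro u
  have hu : u.vec 0 ^ 2 + u.vec 1 ^ 2 = 1 := by
    simpa [u.norm_vec, Fin.sum_univ_two] using (EuclideanSpace.norm_sq_eq u.vec).symm
  obtain ⟨θ, hcos, hsin⟩ := exists_angle_cos_eq_sin_eq hu
  refine ⟨θ, vec_injective (PiLp.ext fun i => ?_)⟩
  fin_cases i
  · exact hcos
  · exact hsin

theorem ofAngle_add_pi (θ : Angle) : ofAngle (θ + π) = -ofAngle θ := by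
  refine vec_injective (PiLp.ext fun i => ?_)
  fin_cases i
  · exact θ.cos_add_pi
  · exact θ.sin_add_pi

end Circle

section Join

variable {p q : ℕ}

theorem inner_toLp_append {m n : ℕ} (a a' : EuclideanSpace ℝ (Fin m))
    (b b' : EuclideanSpace ℝ (Fin n)) :
    inner ℝ (WithLp.toLp 2 (Fin.append a b)) (WithLp.toLp 2 (Fin.append a' b')) =
      inner ℝ a a' + inner ℝ b b' := by
  simp only [PiLp.inner_apply, Fin.sum_univ_add, Fin.append_left, Fin.append_right]

theorem neg_toLp_append {m n : ℕ} (a : EuclideanSpace ℝ (Fin m)) (b : EuclideanSpace ℝ (Fin n)) :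
    -WithLp.toLp 2 (Fin.append a b) = WithLp.toLp 2 (Fin.append (-a).ofLp (-b).ofLp) := by
  ext i
  refine Fin.addCases (fun i => ?_) (fun i => ?_) i <;> simp

theorem exists_toLp_append_eq {m n : ℕ} (v : EuclideanSpace ℝ (Fin (m + n))) :
    ∃ (a : EuclideanSpace ℝ (Fin m)) (b : EuclideanSpace ℝ (Fin n)),
      WithLp.toLp 2 (Fin.append a b) = v :=
  ⟨WithLp.toLp 2 fun i => v (Fin.castAdd n i), WithLp.toLp 2 fun i => v (Fin.natAdd m i),
    PiLp.ext fun i => congr_fun Fin.append_castAdd_natAdd i⟩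

theorem norm_toLp_append_sq {m n : ℕ} (a : EuclideanSpace ℝ (Fin m))
    (b : EuclideanSpace ℝ (Fin n)) :
    ‖WithLp.toLp 2 (Fin.append a b)‖ ^ 2 = ‖a‖ ^ 2 + ‖b‖ ^ 2 := by
  simp only [← real_inner_self_eq_norm_sq, inner_toLp_append]

/-- The point `(cos t • x, sin t • y)` of `𝕊^(p+1+q)`, regarded as the spherical join of `𝕊^p` and
`𝕊^q`. All angles `t` are allowed, but those of the first quadrant already reach every point. -/
noncomputable def join (t : Angle) (x : GeodesicSphere p) (y : GeodesicSphere q) :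
    GeodesicSphere (p + 1 + q) :=
  ⟨WithLp.toLp 2
      (Fin.append (m := p + 1) (n := q + 1) (t.cos • x.vec).ofLp (t.sin • y.vec).ofLp), by
    rw [← sq_eq_sq₀ (norm_nonneg _) zero_le_one]
    refine (norm_toLp_append_sq (t.cos • x.vec) (t.sin • y.vec)).trans ?_
    simp [norm_smul, norm_vec, t.cos_sq_add_sin_sq]⟩

theorem vec_join (t : Angle) (x : GeodesicSphere p) (y : GeodesicSphere q) :
    (join t x y).vec = WithLp.toLp 2
      (Fin.append (m := p + 1) (n := q + 1) (t.cos • x.vec).ofLp (t.sin • y.vec).ofLp) :=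
  rfl

theorem dist_join (t t' : Angle) (x x' : GeodesicSphere p) (y y' : GeodesicSphere q) :
    dist (join t x y) (join t' x' y') =
      arccos (t.cos * t'.cos * cos (dist x x') + t.sin * t'.sin * cos (dist y y')) := by
  rw [dist_def]
  congr 1
  refine (inner_toLp_append (t.cos • x.vec) (t'.cos • x'.vec) (t.sin • y.vec)
    (t'.sin • y'.vec)).trans ?_
  simp only [real_inner_smul_left, real_inner_smul_right, inner_vec]
  ring

theorem neg_join (t : Angle) (x : GeodesicSphere p) (y : GeodesicSphere q) :
    -join t x y = join t (-x) (-y) := by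
  refine vec_injective ((neg_toLp_append (t.cos • x.vec) (t.sin • y.vec)).trans ?_)
  rw [vec_join, vec_neg, vec_neg, smul_neg, smul_neg]

theorem join_zero_congr (x : GeodesicSphere p) (y y' : GeodesicSphere q) :
    join 0 x y = join 0 x y' := by
  rw [← dist_eq_zero, dist_join]
  simp

theorem join_pi_div_two_congr (x x' : GeodesicSphere p) (y : GeodesicSphere q) :
    join (π / 2 : ℝ) x y = join (π / 2 : ℝ) x' y := by
  rw [← dist_eq_zero, dist_join]
  simp

theorem dist_join_le_of_dist_le {t t' : Angle} (ht_cos : 0 ≤ t.cos) (ht_sin : 0 ≤ t.sin)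
    (ht_cos' : 0 ≤ t'.cos) (ht_sin' : 0 ≤ t'.sin) {x x' : GeodesicSphere p}
    {y y' : GeodesicSphere q} {r : ℝ} (hr : π / 2 ≤ r) (hx : dist x x' ≤ r) (hy : dist y y' ≤ r) :
    dist (join t x y) (join t' x' y') ≤ r := by
  rcases le_total π r with hπ | hπ
  · exact (dist_le_pi _ _).trans hπ
  have hcos_nonpos : cos r ≤ 0 := cos_nonpos_of_pi_div_two_le_of_le hr (by linarith)
  have hcos_x : cos r ≤ cos (dist x x') := cos_le_cos_of_nonneg_of_le_pi dist_nonneg hπ hx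
  have hcos_y : cos r ≤ cos (dist y y') := cos_le_cos_of_nonneg_of_le_pi dist_nonneg hπ hy
  have hcos_t : t.cos * t'.cos + t.sin * t'.sin ≤ 1 := by
    rw [← cos_sub_angle, ← Angle.cos_toReal]
    exact cos_le_one _
  rw [dist_join, ← arccos_cos (pi_div_two_pos.le.trans hr) hπ]
  refine arccos_le_arccos ?_
  calc cos r ≤ (t.cos * t'.cos + t.sin * t'.sin) * cos r := by nlinarith
    _ = t.cos * t'.cos * cos r + t.sin * t'.sin * cos r := add_mul _ _ _
    _ ≤ t.cos * t'.cos * cos (dist x x') + t.sin * t'.sin * cos (dist y y') := by gcongr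

theorem dist_join_left (t t' : Angle) (x : GeodesicSphere p) (y : GeodesicSphere q) :
    dist (join t x y) (join t' x y) = dist t t' := by
  rw [dist_join, dist_self, dist_self, cos_zero, mul_one, mul_one, ← cos_sub_angle,
    arccos_cos_angle, dist_eq_norm]

theorem dist_join_middle_le (t : Angle) (x x' : GeodesicSphere p) (y : GeodesicSphere q) :
    dist (join t x y) (join t x' y) ≤ dist x x' := by
  rw [← arccos_cos dist_nonneg (dist_le_pi x x'), dist_join, dist_self, cos_zero, mul_one]
  refine arccos_le_arccos ?_
  nlinarith [t.cos_sq_add_sin_sq, cos_le_one (dist x x'), sq_nonneg t.sin]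

theorem dist_join_le (t t' : Angle) (x x' : GeodesicSphere p) (y : GeodesicSphere q) :
    dist (join t x y) (join t' x' y) ≤ dist t t' + dist x x' :=
  calc dist (join t x y) (join t' x' y)
      ≤ dist (join t x y) (join t' x y) + dist (join t' x y) (join t' x' y) := dist_triangle _ _ _
    _ ≤ dist t t' + dist x x' := by
      rw [dist_join_left]
      gcongr
      exact dist_join_middle_le t' x x' y

theorem exists_norm_smul_vec_eq (a : EuclideanSpace ℝ (Fin (p + 1))) :
    ∃ x : GeodesicSphere p, ‖a‖ • x.vec = a := by
  rcases eq_or_ne a 0 with rfl | ha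
  · exact ⟨Classical.arbitrary _, by simp⟩
  · exact ⟨⟨‖a‖⁻¹ • a, norm_smul_inv_norm ha⟩, smul_inv_smul₀ (norm_ne_zero_iff.mpr ha) a⟩

theorem exists_join_eq (v : GeodesicSphere (p + 1 + q)) :
    ∃ (t : Angle) (x : GeodesicSphere p) (y : GeodesicSphere q),
      0 ≤ t.cos ∧ 0 ≤ t.sin ∧ join t x y = v := by
  obtain ⟨a, b, hv⟩ := exists_toLp_append_eq (m := p + 1) (n := q + 1) v.vec
  have hab : ‖a‖ ^ 2 + ‖b‖ ^ 2 = 1 := by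
    rw [← norm_toLp_append_sq, hv]
    exact (congr_arg (· ^ 2) v.norm_vec).trans (one_pow 2)
  obtain ⟨t, hcos, hsin⟩ := exists_angle_cos_eq_sin_eq hab
  obtain ⟨x, hx⟩ := exists_norm_smul_vec_eq a
  obtain ⟨y, hy⟩ := exists_norm_smul_vec_eq b
  refine ⟨t, x, y, hcos ▸ norm_nonneg a, hsin ▸ norm_nonneg b, vec_injective ?_⟩
  rw [vec_join, hcos, hsin, hx, hy]
  exact hv

end Join

section UpperBound

/-- The correspondence between `𝕊¹` and `𝕊³`, the join of two circles, realising the upper bound: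
the unit complex number `u` is related to the join of `x` and `u³` whenever `x` is at distance at
most `π / 3` from `u`. -/
def cubeRootRel : Set (GeodesicSphere 1 × GeodesicSphere 3) :=
  {p | ∃ (t θ : Angle) (x : GeodesicSphere 1), 0 ≤ t.cos ∧ 0 ≤ t.sin ∧
    dist x (ofAngle θ) ≤ π / 3 ∧ p = (ofAngle θ, join t x (ofAngle (3 • θ)))}

theorem isCorrespondence_cubeRootRel : IsCorrespondence cubeRootRel := by
  constructor <;> refine Set.eq_univ_of_forall fun v => ?_
  · obtain ⟨θ, rfl⟩ := surjective_ofAngle v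
    exact ⟨_, ⟨0, θ, ofAngle θ, by simp, by simp, by rw [dist_self]; positivity, rfl⟩, rfl⟩
  · obtain ⟨t, x, y, hcos, hsin, rfl⟩ := exists_join_eq (p := 1) (q := 1) v
    obtain ⟨β, rfl⟩ := surjective_ofAngle x
    obtain ⟨α, rfl⟩ := surjective_ofAngle y
    obtain ⟨θ, rfl, hθ⟩ := exists_nsmul_eq_dist_le three_ne_zero α β
    rw [← isometry_ofAngle.dist_eq] at hθ
    exact ⟨_, ⟨t, θ, _, hcos, hsin, hθ, rfl⟩, rfl⟩

theorem neg_mem_cubeRootRel {p : GeodesicSphere 1 × GeodesicSphere 3} (hp : p ∈ cubeRootRel) :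
    (-p.1, -p.2) ∈ cubeRootRel := by
  obtain ⟨t, θ, x, hcos, hsin, hx, rfl⟩ := hp
  refine ⟨t, θ + π, -x, hcos, hsin, ?_, ?_⟩
  · rwa [ofAngle_add_pi, dist_neg_left, dist_neg_right, sub_sub_cancel]
  · have hpi : 3 • (π : Angle) = π := by
      rw [succ_nsmul, Angle.two_nsmul_coe_pi, zero_add]
    rw [smul_add, hpi, ofAngle_add_pi, ofAngle_add_pi, neg_join]

theorem dist_snd_le_of_mem_cubeRootRel {p q : GeodesicSphere 1 × GeodesicSphere 3}
    (hp : p ∈ cubeRootRel) (hq : q ∈ cubeRootRel) :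
    dist p.2 q.2 ≤ 2 * π / 3 + dist p.1 q.1 := by
  obtain ⟨t, θ, x, hcos, hsin, hx, rfl⟩ := hp
  obtain ⟨t', θ', x', hcos', hsin', hx', rfl⟩ := hq
  have hfst : dist x x' ≤ 2 * π / 3 + dist (ofAngle θ) (ofAngle θ') := by
    have htri := dist_triangle4 x (ofAngle θ) (ofAngle θ') x'
    rw [dist_comm (ofAngle θ') x'] at htri
    linarith
  have hsnd : dist (ofAngle (3 • θ)) (ofAngle (3 • θ')) ≤
      2 * π / 3 + dist (ofAngle θ) (ofAngle θ') := by
    have hcube : dist (ofAngle (3 • θ)) (ofAngle (3 • θ')) ≤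
        3 * dist (ofAngle θ) (ofAngle θ') := by
      simp only [isometry_ofAngle.dist_eq, dist_eq_norm, ← smul_sub]
      exact (norm_nsmul_le (n := 3) (a := θ - θ')).trans_eq (by norm_num)
    -- `min (3 * d) π ≤ 2 * π / 3 + d` for every `d`, with equality at `d = π / 3`.
    linarith [dist_le_pi (ofAngle (3 • θ)) (ofAngle (3 • θ'))]
  have hr : π / 2 ≤ 2 * π / 3 + dist (ofAngle θ) (ofAngle θ') := by
    linarith [pi_pos, dist_nonneg (x := ofAngle θ) (y := ofAngle θ')]
  exact dist_join_le_of_dist_le hcos hsin hcos' hsin' hr hfst hsnd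

theorem distortion_cubeRootRel_le : distortion cubeRootRel ≤ ENNReal.ofReal (2 * π / 3) := by
  refine distortion_le_ofReal fun p hp q hq => abs_sub_le_iff.mpr ⟨?_, ?_⟩
  -- The antipodal symmetry turns the upper bound on `dist p.2 (-q.2)` into a lower one.
  · have hneg := dist_snd_le_of_mem_cubeRootRel hp (neg_mem_cubeRootRel hq)
    rw [dist_neg_right, dist_neg_right] at hneg
    linarith
  · linarith [dist_snd_le_of_mem_cubeRootRel hp hq]

end UpperBound

section LowerBound

variable {n q : ℕ}

/-- A grid on the hemisphere spanned by `𝕊¹` and the pole `y`, with step `π / (2 * M)`: `i` measures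
the height above the equator `𝕊¹`, so that row `M` is the pole, and `j` the longitude, of period
`2 * (2 * M)`. -/
noncomputable def hemisphereGrid (y : GeodesicSphere q) (M i j : ℕ) : GeodesicSphere (1 + 1 + q) :=
  join (i * (π / (2 * M)) : ℝ) (ofAngle (j * (π / (2 * M)) : ℝ)) y

theorem dist_hemisphereGrid_le (y : GeodesicSphere q) (M i j : ℕ) {a b : ℕ} (ha : a ≤ 1)
    (hb : b ≤ 1) :
    dist (hemisphereGrid y M i j) (hemisphereGrid y M (i + a) (j + b)) ≤ π / M := by
  have hcoord (k : ℕ) {c : ℕ} (hc : c ≤ 1) :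
      dist ((k * (π / (2 * M)) : ℝ) : Angle) (((k + c : ℕ) * (π / (2 * M)) : ℝ) : Angle) ≤
        π / (2 * M) := by
    rw [Nat.cast_add, add_mul, Angle.coe_add, dist_self_add_right]
    refine (norm_coe_angle_le _).trans ?_
    rw [abs_of_nonneg (by positivity)]
    exact mul_le_of_le_one_left (by positivity) (by exact_mod_cast hc)
  calc dist (hemisphereGrid y M i j) (hemisphereGrid y M (i + a) (j + b))
      ≤ π / (2 * M) + π / (2 * M) := by
        refine (dist_join_le _ _ _ _ _).trans ?_
        rw [isometry_ofAngle.dist_eq]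
        exact add_le_add (hcoord i ha) (hcoord j hb)
    _ = π / M := by ring

theorem ofAngle_add_half_period {M : ℕ} (hM : M ≠ 0) (j : ℕ) :
    ofAngle (((j + 2 * M : ℕ) * (π / (2 * M)) : ℝ) : Angle) =
      -ofAngle ((j * (π / (2 * M)) : ℝ) : Angle) := by
  rw [← ofAngle_add_pi, ← Angle.coe_add]
  congr 2
  push_cast
  field_simp

theorem hemisphereGrid_add_period (y : GeodesicSphere q) {M : ℕ} (hM : M ≠ 0) (i j : ℕ) :
    hemisphereGrid y M i (j + 2 * (2 * M)) = hemisphereGrid y M i j := by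
  rw [two_mul (2 * M), ← add_assoc, hemisphereGrid, hemisphereGrid, ofAngle_add_half_period hM,
    ofAngle_add_half_period hM, neg_neg]

theorem hemisphereGrid_equator_add_two_mul (y : GeodesicSphere q) {M : ℕ} (hM : M ≠ 0) (j : ℕ) :
    hemisphereGrid y M 0 (j + 2 * M) = -hemisphereGrid y M 0 j := by
  rw [hemisphereGrid, hemisphereGrid, ofAngle_add_half_period hM, neg_join, Nat.cast_zero,
    zero_mul, Angle.coe_zero]
  exact join_zero_congr _ _ _

theorem hemisphereGrid_pole (y : GeodesicSphere q) {M : ℕ} (hM : M ≠ 0) (j : ℕ) :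
    hemisphereGrid y M M j = hemisphereGrid y M M 0 := by
  have hheight : (M * (π / (2 * M)) : ℝ) = π / 2 := by
    field_simp
  rw [hemisphereGrid, hemisphereGrid, hheight]
  exact join_pi_div_two_congr _ _ _

theorem exists_dist_lt_two_pi_div_three_le_dist {f : GeodesicSphere (1 + 1 + q) → Angle}
    (hf : Semiconj f Neg.neg (· + (π : Angle))) {ε : ℝ} (hε : 0 < ε) :
    ∃ x y, dist x y < ε ∧ 2 * π / 3 ≤ dist (f x) (f y) := by
  by_contra! hclose
  obtain ⟨M, hM⟩ := exists_nat_gt (π / ε)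
  have hM_pos : (0 : ℝ) < M := (by positivity : 0 < π / ε).trans hM
  have hM_ne : M ≠ 0 := by exact_mod_cast hM_pos.ne'
  let y : GeodesicSphere q := Classical.arbitrary _
  let F (i j : ℕ) : Angle := f (hemisphereGrid y M i j)
  have hrow : turning (F M) (2 * (2 * M)) = turning (F 0) (2 * (2 * M)) := by
    refine turning_row_eq (fun i => ?_) (fun i j a ha b hb => hclose _ _ ?_) M
    · simpa only [zero_add] using congr_arg f (hemisphereGrid_add_period y hM_ne i 0)
    · exact (dist_hemisphereGrid_le y M i j ha hb).trans_lt ((div_lt_comm₀ hε hM_pos).mp hM)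
  have hpole : turning (F M) (2 * (2 * M)) = 0 :=
    turning_eq_zero_of_forall_eq (fun j => congr_arg f (hemisphereGrid_pole y hM_ne j)) _
  have hequator : turning (F 0) (2 * (2 * M)) ≠ 0 :=
    turning_two_mul_ne_zero_of_antiperiodic fun j => by
      simp only [F, hemisphereGrid_equator_add_two_mul y hM_ne, hf.eq]
  exact hequator (hrow.symm.trans hpole)

theorem exists_odd_abs_dist_sub_dist_le {R : Set (GeodesicSphere 1 × GeodesicSphere n)}
    (hR : Surjective fun p : R => p.1.2) (hfin : distortion R ≠ ⊤) :
    ∃ f : GeodesicSphere n → Angle, Semiconj f Neg.neg (· + (π : Angle)) ∧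
      ∀ x y, |dist (f x) (f y) - dist x y| ≤ (distortion R).toReal := by
  have hpi_invol : Involutive (· + (π : Angle)) := fun θ => by
    simp only [add_assoc, Angle.coe_pi_add_coe_pi, add_zero]
  obtain ⟨f, hf, hfR⟩ := exists_semiconj_of_forall_exists neg_involutive neg_ne_self hpi_invol
    (S := fun x θ => (ofAngle θ, x) ∈ R ∨ (-ofAngle θ, -x) ∈ R)
    (fun x θ h => by rw [ofAngle_add_pi, neg_neg, neg_neg]; exact h.symm)
    (fun x => by
      obtain ⟨⟨⟨u, x⟩, hux⟩, rfl⟩ := hR x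
      obtain ⟨θ, rfl⟩ := surjective_ofAngle u
      exact ⟨θ, Or.inl hux⟩)
  refine ⟨f, hf, fun x y => ?_⟩
  rw [← isometry_ofAngle.dist_eq]
  rcases hfR x with hx | hx <;> rcases hfR y with hy | hy
  · exact abs_dist_sub_dist_le_toReal_distortion hfin hx hy
  · rw [← abs_dist_neg_right_sub_dist_neg_right]
    exact abs_dist_sub_dist_le_toReal_distortion hfin hx hy
  · rw [← abs_dist_neg_left_sub_dist_neg_left]
    exact abs_dist_sub_dist_le_toReal_distortion hfin hx hy
  · rw [← abs_dist_neg_left_sub_dist_neg_left, ← abs_dist_neg_right_sub_dist_neg_right]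
    exact abs_dist_sub_dist_le_toReal_distortion hfin hx hy

theorem two_pi_div_three_le_distortion (hn : 2 ≤ n)
    {R : Set (GeodesicSphere 1 × GeodesicSphere n)} (hR : Surjective fun p : R => p.1.2) :
    ENNReal.ofReal (2 * π / 3) ≤ distortion R := by
  obtain ⟨q, rfl⟩ := Nat.exists_eq_add_of_le hn
  by_contra! hlt
  have hfin : distortion R ≠ ⊤ := hlt.ne_top
  obtain ⟨f, hf, hdist⟩ := exists_odd_abs_dist_sub_dist_le hR hfin
  have hgap : 0 < 2 * π / 3 - (distortion R).toReal :=
    sub_pos.mpr ((ENNReal.lt_ofReal_iff_toReal_lt hfin).mp hlt)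
  obtain ⟨x, y, hxy, hjump⟩ := exists_dist_lt_two_pi_div_three_le_dist hf hgap
  linarith [le_of_abs_le (hdist x y)]

end LowerBound

end GeodesicSphere

open GeodesicSphere

theorem mainTheorem3 :
    (∃ R : Set (GeodesicSphere 1 × GeodesicSphere 3),
      IsCorrespondence R ∧ distortion R ≤ ENNReal.ofReal (2 * Real.pi / 3)) ∧
    GromovHausdorff.ghDist (GeodesicSphere 1) (GeodesicSphere 3) = Real.pi / 3 := by
  refine ⟨⟨cubeRootRel, isCorrespondence_cubeRootRel, distortion_cubeRootRel_le⟩,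
    le_antisymm ?_ ?_⟩
  · have hle := isCorrespondence_cubeRootRel.ofReal_two_mul_ghDist_le_distortion.trans
      distortion_cubeRootRel_le
    rw [ENNReal.ofReal_le_ofReal_iff (by positivity)] at hle
    linarith
  · obtain ⟨R, hR, hdis⟩ :=
      exists_isCorrespondence_distortion_le_ghDist (GeodesicSphere 1) (GeodesicSphere 3)
    have hge := (two_pi_div_three_le_distortion (by norm_num) hR.surjective_snd).trans hdis
    rw [ENNReal.ofReal_le_ofReal_iff'] at hge
    rcases hge with hge | hge <;> linarith [pi_pos]
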